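/- Let $\mathbb{H}$ be the skew-field of quaternions, $\mathbb{D}=\{x\in\mathbb{H}:|x|<1\}$ and $\mathbb{S}=\{i\in\mathbb{H}:\operatorname{Re} i=0,\ |i|=1\}$. For $i\in\mathbb{S}$ put $\mathbb{C}_i=\{x_0+ix_1:x_0,x_1\in\mathbb{R}\}$, $\mathbb{D}_i=\mathbb{D}\cap\mathbb{C}_i$ and $e^{i\theta}=\cos\theta+i\sin\theta$. A real differentiable function $f:\mathbb{D}\to\mathbb{H}$ is (left) slice hyperholomorphic, $f\in\mathcal{SH}_L(\mathbb{D})$, if there are $\mathbb{H}$-valued functions $\alpha,\beta$ on $\{(x_0,x_1)\in\mathbb{R}^2: x_0^2+x_1^2<1\}$ with $f(x_0+ix_1)=\alpha(x_0,x_1)+i\beta(x_0,x_1)$ for all $i\in\mathbb{S}$, $\alpha(x_0,-x_1)=\alpha(x_0,x_1)$, $\beta(x_0,-x_1)=-\beta(x_0,x_1)$, $\partial_{x_0}\alpha=\partial_{x_1}\beta$ and $\partial_{x_0}\beta=-\partial_{x_1}\alpha$. Its slice derivative at $s\in\mathbb{D}$ is $\partial_S f(s)=\lim_{p\to s,\,p\in\mathbb{C}_{i_s}\setminus\{s\}}(p-s)^{-1}(f(p)-f(s))$,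 where $i_s\in\mathbb{S}$ is such that $s\in\mathbb{C}_{i_s}$. The Dirichlet space $\mathcal{D}(\mathbb{D})$ consists of all $f\in\mathcal{SH}_L(\mathbb{D})$ with \[\sup_{i\in\mathbb{S}}\int_{\mathbb{D}_i}|\partial_S f(s)|^2\,d\lambda_2(s)<+\infty,\] where $\lambda_2$ is the two-dimensional Lebesgue measure on $\mathbb{C}_i\cong\mathbb{R}^2$. The Hardy space $\mathcal{H}^2(\mathbb{D})$ consists of all $f\in\mathcal{SH}_L(\mathbb{D})$ with \[\sup_{i\in\mathbb{S}}\lim_{r\nearrow1}\Big(\frac1{2\pi}\int_0^{2\pi}|f(re^{i\theta})|^2\,d\theta\Big)^{1/2}<+\infty;\] for such $f$ and $i\in\mathbb{S}$ the radial limit $f(e^{i\theta}):=\lim_{r\nearrow1}f(re^{i\theta})$ exists for almost every $\theta\in\mathbb{R}$. For a bounded open interval $I=(a,b)\subset\mathbb{R}$, $a<b$, of length $|I|=b-a\le2\pi$ put \[f_{I,i}=\frac1{|I|}\int_I f(e^{i\theta})\,d\theta,\qquad \mathrm{MO}_i(f,I)=\frac1{|I|}\int_I\big|f(e^{i\theta})-f_{I,i}\big|^2\,d\theta.\]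 The space $\mathrm{BMOSH}(\mathbb{D})$ consists of all $f\in\mathcal{H}^2(\mathbb{D})$ with $\sup_{i\in\mathbb{S}}\sup_{|I|\le2\pi}\mathrm{MO}_i(f,I)^{1/2}<+\infty$, and $\mathrm{VMOSH}(\mathbb{D})$ consists of all $f\in\mathrm{BMOSH}(\mathbb{D})$ such that, for every $i\in\mathbb{S}$, $\mathrm{MO}_i(f,I)\to0$ as $|I|\to0$, uniformly in the position of $I$. **Lemma.** $\mathcal{D}(\mathbb{D})\subset\mathrm{VMOSH}(\mathbb{D})$. -/

import Mathlib

open scoped Quaternion ENNReal Topology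

noncomputable section

namespace SliceHyper

/-- The sphere `𝕊` of quaternionic imaginary units. -/
def imagUnits : Set ℍ[ℝ] := {i | i.re = 0 ∧ ‖i‖ = 1}

/-- The point `x₀ + i x₁` of the plane `ℂ_i` that corresponds to the complex number
`z = x₀ + ι x₁`. For `i ∈ 𝕊` this is an isometric isomorphism of `ℂ` onto `ℂ_i`. -/
def slicePoint (i : ℍ[ℝ]) (z : ℂ) : ℍ[ℝ] := (z.re : ℍ[ℝ]) + i * (z.im : ℍ[ℝ])

/-- The complex plane `ℂ_i = {x₀ + i x₁ : x₀, x₁ ∈ ℝ}`. -/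
def slicePlane (i : ℍ[ℝ]) : Set ℍ[ℝ] := Set.range (slicePoint i)

/-- The imaginary unit `i_x` of `x`: the normalized imaginary part of `x` if `x` is not real,
and some fixed imaginary unit if `x` is real. -/
def unitOf (x : ℍ[ℝ]) : ℍ[ℝ] :=
  open Classical in if x.im = 0 then ⟨0, 1, 0, 0⟩ else ‖x.im‖⁻¹ • x.im

/-- The open unit ball of the quaternions. -/
def unitBall : Set ℍ[ℝ] := Metric.ball 0 1

/-- Left slice hyperholomorphic functions on an axially symmetric open set `U`. Only the values
of `f` on `U` matter, and only the values of `α` and `β` at pairs `(x₀, x₁)` with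
`x₀ + i x₁ ∈ U`. In the Cauchy-Riemann system `a = ∂₀α = ∂₁β` and `b = ∂₀β = -∂₁α`. -/
def SliceHyperholomorphicOn (f : ℍ[ℝ] → ℍ[ℝ]) (U : Set ℍ[ℝ]) : Prop :=
  DifferentiableOn ℝ f U ∧
  ∃ α β : ℝ → ℝ → ℍ[ℝ], ∀ i ∈ imagUnits, ∀ x₀ x₁ : ℝ, slicePoint i ⟨x₀, x₁⟩ ∈ U →
    f (slicePoint i ⟨x₀, x₁⟩) = α x₀ x₁ + i * β x₀ x₁ ∧
    α x₀ (-x₁) = α x₀ x₁ ∧ β x₀ (-x₁) = -β x₀ x₁ ∧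
    ∃ a b : ℍ[ℝ],
      HasDerivAt (fun t => α t x₁) a x₀ ∧ HasDerivAt (fun t => β x₀ t) a x₁ ∧
      HasDerivAt (fun t => β t x₁) b x₀ ∧ HasDerivAt (fun t => α x₀ t) (-b) x₁

/-- The slice derivative of `f` at `s`: the limit of `(p - s)⁻¹ (f p - f s)` as `p → s`,
`p ≠ s`, in the plane `ℂ_{i_s}`. -/
def sliceDeriv (f : ℍ[ℝ] → ℍ[ℝ]) (s : ℍ[ℝ]) : ℍ[ℝ] :=
  Filter.limUnder (𝓝[slicePlane (unitOf s) \ {s}] s) (fun p => (p - s)⁻¹ * (f p - f s))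

/-- The slice hyperholomorphic Dirichlet space: `sup_i ∫_{𝔻_i} |∂_S f|² dλ₂ < ∞`. -/
def dirichletSpace : Set (ℍ[ℝ] → ℍ[ℝ]) :=
  {f | SliceHyperholomorphicOn f unitBall ∧
    (⨆ i ∈ imagUnits,
      ∫⁻ z in Metric.ball (0 : ℂ) 1, ‖sliceDeriv f (slicePoint i z)‖ₑ ^ 2) < ∞}

/-- The point `r e^{iθ}` of `ℂ_i`. -/
def polarPoint (i : ℍ[ℝ]) (r θ : ℝ) : ℍ[ℝ] := slicePoint i (circleMap 0 r θ)

/-- The integral mean `((1/2π) ∫₀^{2π} |f(r e^{iθ})|^p dθ)^{1/p}`. -/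
def hardyMean (p : ℝ) (f : ℍ[ℝ] → ℍ[ℝ]) (i : ℍ[ℝ]) (r : ℝ) : ℝ≥0∞ :=
  ((ENNReal.ofReal (2 * Real.pi))⁻¹ *
    ∫⁻ θ in Set.Ioc 0 (2 * Real.pi), ‖f (polarPoint i r θ)‖ₑ ^ p) ^ (1 / p)

/-- The slice hyperholomorphic Hardy space `ℋ^p(𝔻)`: the limits of the integral means as `r ↗ 1`
have finite supremum over all imaginary units `i`. -/
def hardySpace (p : ℝ) : Set (ℍ[ℝ] → ℍ[ℝ]) :=
  {f | SliceHyperholomorphicOn f unitBall ∧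
    ∃ L : ℍ[ℝ] → ℝ≥0∞,
      (∀ i ∈ imagUnits, Filter.Tendsto (hardyMean p f i) (𝓝[<] 1) (𝓝 (L i))) ∧
      (⨆ i ∈ imagUnits, L i) < ∞}

/-- The boundary value `f(e^{iθ})`, i.e. the radial limit `lim_{r ↗ 1} f(r e^{iθ})`. -/
def boundaryValue (f : ℍ[ℝ] → ℍ[ℝ]) (i : ℍ[ℝ]) (θ : ℝ) : ℍ[ℝ] :=
  Filter.limUnder (𝓝[<] (1 : ℝ)) (fun r => f (polarPoint i r θ))

/-- The mean oscillation `(1/|I|) ∫_I |f(e^{iθ}) - f_{I,i}|² dθ` on `I = (a, b)`, where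
`f_{I,i} = (1/|I|) ∫_I f(e^{iφ}) dφ`. -/
def meanOsc (f : ℍ[ℝ] → ℍ[ℝ]) (i : ℍ[ℝ]) (a b : ℝ) : ℝ≥0∞ :=
  (ENNReal.ofReal (b - a))⁻¹ * ∫⁻ θ in Set.Ioo a b,
    ‖boundaryValue f i θ - (b - a)⁻¹ • ∫ φ in Set.Ioo a b, boundaryValue f i φ‖ₑ ^ 2

/-- The seminorm `|f|_{BMOSH(𝔻_i)}`; its square is the supremum of the mean oscillations over all
intervals `I = (a, b)` with `|I| ≤ 2π`. -/
def bmoSliceSeminorm (f : ℍ[ℝ] → ℍ[ℝ]) (i : ℍ[ℝ]) : ℝ≥0∞ :=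
  (⨆ (a : ℝ) (b : ℝ) (_ : a < b) (_ : b - a ≤ 2 * Real.pi), meanOsc f i a b) ^ (1 / 2 : ℝ)

/-- The seminorm `|f|_{BMOSH(𝔻)}`. -/
def bmoSeminorm (f : ℍ[ℝ] → ℍ[ℝ]) : ℝ≥0∞ := ⨆ i ∈ imagUnits, bmoSliceSeminorm f i

/-- The space `BMOSH(𝔻)`. The almost everywhere existence of the radial limits, automatic for
functions in `ℋ²(𝔻)`, is listed to make the boundary values meaningful. -/
def BMOSH : Set (ℍ[ℝ] → ℍ[ℝ]) :=
  {f | f ∈ hardySpace 2 ∧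
    (∀ i ∈ imagUnits, ∀ᵐ θ : ℝ, ∃ l : ℍ[ℝ],
      Filter.Tendsto (fun r => f (polarPoint i r θ)) (𝓝[<] (1 : ℝ)) (𝓝 l)) ∧
    bmoSeminorm f < ∞}

/-- The space `VMOSH(𝔻)`: for each `i ∈ 𝕊` the mean oscillation over `I = (a, b)` tends to zero
as the length `b - a > 0` tends to zero, uniformly in the position of `I`. -/
def VMOSH : Set (ℍ[ℝ] → ℍ[ℝ]) :=
  {f | f ∈ BMOSH ∧ ∀ i ∈ imagUnits,
    Filter.Tendsto (fun I : ℝ × ℝ => meanOsc f i I.1 I.2)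
      (Filter.comap (fun I : ℝ × ℝ => I.2 - I.1) (𝓝[>] 0)) (𝓝 0)}

end SliceHyper

end

open scoped Quaternion ENNReal Topology
open MeasureTheory Set Filter

namespace SliceHyper

/-! In a plane `ℂ_i`, write `f` in polar coordinates as `u r θ`. The Cauchy-Riemann system makes the
restriction holomorphic for left multiplication by `ℂ_i`, so the angular derivative has norm `r`
times that of the radial derivative `v`. Let `e δ` be the integral of `‖v‖²` over the annulus `1 - δ
< r < 1`. For `δ ≤ 1/2` it is at most twice the Dirichlet integral, and it tends to `0` with `δ` by
absolute continuity of the integral.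

Given an interval `I = (a, b)`, take `δ = min |I| (1/2)`. Averaging over `r` yields a circle in the
annulus with `δ ∫_I ‖v r θ‖² dθ ≤ e δ`. Cauchy-Schwarz along radii compares the boundary value with
`u r θ`, and along the arc compares `u r θ` with the constant `u r a`. Hence the mean oscillation
over `I` is at most a universal multiple of `e δ` (`meanOsc_radialLimit_le`). The bound ignores the
position of `I`, which gives VMO; bounding `e δ` by the Dirichlet supremum gives BMO uniformly in
`i`. The radial estimate also yields the radial limits and the convergence of the `L²` means
required by the Hardy space. -/

/-! ### Quadratic inequalities, radial limits and mean oscillation on an interval. -/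

theorem ennreal_add_sq_le (x y : ℝ≥0∞) : (x + y) ^ 2 ≤ 2 * (x ^ 2 + y ^ 2) := by
  have h := ENNReal.rpow_add_le_mul_rpow_add_rpow x y (p := 2) one_le_two
  norm_num at h
  exact h

theorem enorm_sub_sq_le {E : Type*} [NormedAddCommGroup E] (x y z : E) :
    ‖x - z‖ₑ ^ 2 ≤ 2 * (‖x - y‖ₑ ^ 2 + ‖y - z‖ₑ ^ 2) := by
  refine le_trans ?_ (ennreal_add_sq_le _ _)
  gcongr
  rw [← sub_add_sub_cancel x y z]
  exact enorm_add_le _ _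

/-- The Cauchy-Schwarz inequality against a constant. -/
theorem lintegral_sq_le_measure_mul {α : Type*} [MeasurableSpace α] {μ : Measure α}
    {φ : α → ℝ≥0∞} (hφ : AEMeasurable φ μ) :
    (∫⁻ x, φ x ∂μ) ^ 2 ≤ μ univ * ∫⁻ x, φ x ^ 2 ∂μ := by
  have h := ENNReal.lintegral_mul_le_Lp_mul_Lq μ Real.HolderConjugate.two_two
    (f := fun _ => 1) (g := φ) aemeasurable_const hφ
  simp only [Pi.mul_apply, one_mul, lintegral_const, ENNReal.rpow_two, one_pow] at h
  calc (∫⁻ x, φ x ∂μ) ^ 2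
      ≤ (μ univ ^ (1 / 2 : ℝ) * (∫⁻ x, φ x ^ 2 ∂μ) ^ (1 / 2 : ℝ)) ^ 2 := by gcongr
    _ = _ := by
      rw [mul_pow, ← ENNReal.rpow_two, ← ENNReal.rpow_two, ← ENNReal.rpow_mul,
        ← ENNReal.rpow_mul]
      norm_num

variable {E : Type*} [NormedAddCommGroup E] [NormedSpace ℝ E]

/-- The quadratic form of the fundamental theorem of calculus. -/
theorem enorm_sub_sq_le_lintegral_deriv [CompleteSpace E] {h h' : ℝ → E} {a b : ℝ} (hab : a ≤ b)
    (hd : ∀ x ∈ Icc a b, HasDerivAt h (h' x) x) (hc : ContinuousOn h' (Icc a b)) :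
    ‖h b - h a‖ₑ ^ 2 ≤ ENNReal.ofReal (b - a) * ∫⁻ x in Ioc a b, ‖h' x‖ₑ ^ 2 := by
  have hi : IntervalIntegrable h' volume a b :=
    ContinuousOn.intervalIntegrable (by rwa [uIcc_of_le hab])
  rw [← intervalIntegral.integral_eq_sub_of_hasDerivAt (by rwa [uIcc_of_le hab]) hi,
    intervalIntegral.integral_of_le hab]
  have hm : AEMeasurable (fun x => ‖h' x‖ₑ) (volume.restrict (Ioc a b)) := hi.1.1.enorm
  calc _ ≤ (∫⁻ x in Ioc a b, ‖h' x‖ₑ) ^ 2 := by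
        gcongr
        exact enorm_integral_le_lintegral_enorm _
    _ ≤ _ := by
        refine (lintegral_sq_le_measure_mul hm).trans (le_of_eq ?_)
        rw [Measure.restrict_apply_univ, Real.volume_Ioc]

/-- A function on `(s, 1)` with square integrable derivative has a limit at `1`. -/
theorem exists_tendsto_of_lintegral_deriv_sq [CompleteSpace E] {h h' : ℝ → E} {s : ℝ} (hs : s < 1)
    (hd : ∀ x ∈ Ioo s 1, HasDerivAt h (h' x) x) (hc : ContinuousOn h' (Ioo s 1))
    (hfin : ∫⁻ x in Ioo s 1, ‖h' x‖ₑ ^ 2 ≠ ∞) :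
    ∃ l, Tendsto h (𝓝[<] 1) (𝓝 l) ∧ ∀ r ∈ Ioo s 1,
      ‖l - h r‖ₑ ^ 2 ≤ ENNReal.ofReal (1 - r) * ∫⁻ x in Ioo r 1, ‖h' x‖ₑ ^ 2 := by
  have key : ∀ r ∈ Ioo s 1, ∀ t ∈ Ico r 1,
      ‖h t - h r‖ₑ ^ 2 ≤ ENNReal.ofReal (1 - r) * ∫⁻ x in Ioo r 1, ‖h' x‖ₑ ^ 2 := by
    intro r hr t ht
    have hsub : Icc r t ⊆ Ioo s 1 := fun x hx => ⟨hr.1.trans_le hx.1, hx.2.trans_lt ht.2⟩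
    refine (enorm_sub_sq_le_lintegral_deriv ht.1 (fun x hx => hd x (hsub hx))
      (hc.mono hsub)).trans ?_
    have h1 : Ioc r t ⊆ Ioo r 1 := fun x hx => ⟨hx.1, hx.2.trans_lt ht.2⟩
    gcongr
    exact ht.2.le
  have hmem : Ioo s 1 ∈ 𝓝[<] (1 : ℝ) := Ioo_mem_nhdsLT hs
  have hcauchy : Cauchy (map h (𝓝[<] (1 : ℝ))) := by
    rw [EMetric.cauchy_iff]
    refine ⟨NeBot.ne inferInstance, fun ε hε => ?_⟩
    set K := ∫⁻ x in Ioo s 1, ‖h' x‖ₑ ^ 2 with hK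
    -- Comparing two points of `[r, 1)` through `h r` costs `2 * (A + A)` with `A = (1 - r) K`,
    -- whence the two factors `2`.
    have hlim : Tendsto (fun r : ℝ => 2 * (2 * (ENNReal.ofReal (1 - r) * K))) (𝓝[<] 1) (𝓝 0) := by
      have h0 : Tendsto (fun r : ℝ => ENNReal.ofReal (1 - r)) (𝓝[<] 1) (𝓝 0) := by
        have : Tendsto (fun r : ℝ => ENNReal.ofReal (1 - r)) (𝓝 1) (𝓝 (ENNReal.ofReal (1 - 1))) :=
          (ENNReal.continuous_ofReal.comp (continuous_const.sub continuous_id)).tendsto 1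
        simpa using this.mono_left nhdsWithin_le_nhds
      have h1 := ENNReal.Tendsto.const_mul (a := 2)
        (ENNReal.Tendsto.const_mul (a := 2) (ENNReal.Tendsto.mul_const (b := K) h0 (Or.inr hfin))
        (Or.inr (by simp))) (Or.inr (by simp))
      simpa using h1
    have hε2 : 0 < ε ^ 2 := by positivity
    obtain ⟨r, hr1, hr2⟩ := ((hlim.eventually (gt_mem_nhds hε2)).and hmem).exists
    refine ⟨h '' Ico r 1, image_mem_map (Ico_mem_nhdsLT hr2.2), ?_⟩
    rintro _ ⟨x, hx, rfl⟩ _ ⟨y, hy, rfl⟩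
    rw [edist_eq_enorm_sub]
    have hKr : ∫⁻ x in Ioo r 1, ‖h' x‖ₑ ^ 2 ≤ K := by
      rw [hK]
      exact lintegral_mono_set (Ioo_subset_Ioo_left hr2.1.le)
    rw [← ENNReal.pow_lt_pow_left_iff two_ne_zero]
    refine lt_of_le_of_lt ?_ hr1
    refine (enorm_sub_sq_le (h x) (h r) (h y)).trans ?_
    rw [two_mul (2 * (ENNReal.ofReal (1 - r) * K)), ← mul_add]
    have hx' := key r hr2 x hx
    have hy' := key r hr2 y hy
    rw [← enorm_neg, neg_sub] at hy'
    gcongr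
    · exact hx'.trans (by gcongr)
    · exact hy'.trans (by gcongr)
  obtain ⟨l, hl⟩ := CompleteSpace.complete hcauchy
  refine ⟨l, hl, fun r hr => ?_⟩
  have hl' : Tendsto (fun t => ‖h t - h r‖ₑ ^ 2) (𝓝[<] 1) (𝓝 (‖l - h r‖ₑ ^ 2)) := by
    have hcont : Continuous fun x : E => ‖x - h r‖ₑ ^ 2 := by fun_prop
    exact (hcont.tendsto l).comp hl
  exact le_of_tendsto hl' (by
    filter_upwards [Ico_mem_nhdsLT hr.2] with t ht using key r hr t ht)

/-- The mean is, up to a factor, the best constant approximation in the quadratic mean. -/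
theorem lintegral_sub_average_sq_le [CompleteSpace E] {g : ℝ → E} {a b : ℝ} (hab : a < b)
    (hg : AEStronglyMeasurable g (volume.restrict (Ioo a b))) (c : E) :
    ∫⁻ θ in Ioo a b, ‖g θ - (b - a)⁻¹ • ∫ φ in Ioo a b, g φ‖ₑ ^ 2 ≤
      4 * ∫⁻ θ in Ioo a b, ‖g θ - c‖ₑ ^ 2 := by
  set μ := volume.restrict (Ioo a b) with hμ
  have hba : 0 < b - a := sub_pos.2 hab
  have hμu : μ univ = ENNReal.ofReal (b - a) := by simp [hμ]
  have : IsFiniteMeasure μ := ⟨by rw [hμu]; exact ENNReal.ofReal_lt_top⟩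
  set Q := ∫⁻ θ, ‖g θ - c‖ₑ ^ 2 ∂μ with hQ
  rcases eq_or_ne Q ∞ with hQt | hQt
  · rw [hQt]; simp
  have hm : AEStronglyMeasurable (fun θ => g θ - c) μ := hg.sub aestronglyMeasurable_const
  have hcs : (∫⁻ θ, ‖g θ - c‖ₑ ∂μ) ^ 2 ≤ ENNReal.ofReal (b - a) * Q := by
    rw [← hμu]; exact lintegral_sq_le_measure_mul hm.enorm
  have hint : Integrable (fun θ => g θ - c) μ := by
    refine ⟨hm, ?_⟩
    have h1 : (∫⁻ θ, ‖g θ - c‖ₑ ∂μ) ^ 2 < ∞ :=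
      hcs.trans_lt (ENNReal.mul_lt_top ENNReal.ofReal_lt_top hQt.lt_top)
    exact (ENNReal.pow_lt_top_iff.1 h1).resolve_right two_ne_zero
  have havg : (b - a)⁻¹ • ∫ φ, g φ ∂μ - c = (b - a)⁻¹ • ∫ φ, (g φ - c) ∂μ := by
    have hgi : Integrable g μ := by
      refine (hint.add (integrable_const c)).congr (ae_of_all _ fun x => ?_)
      simp
    rw [integral_sub hgi (integrable_const c), integral_const, Measure.real, hμu,
      ENNReal.toReal_ofReal hba.le, smul_sub, inv_smul_smul₀ hba.ne']
  -- The mean of `g` minus `c` is the mean of `g - c`, so Cauchy-Schwarz bounds its contribution by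
  -- `Q` again.
  have hdiff : ENNReal.ofReal (b - a) * ‖c - (b - a)⁻¹ • ∫ φ, g φ ∂μ‖ₑ ^ 2 ≤ Q := by
    rw [← enorm_neg, neg_sub, havg, enorm_smul, mul_pow]
    have h1 : ‖∫ φ, (g φ - c) ∂μ‖ₑ ^ 2 ≤ ENNReal.ofReal (b - a) * Q :=
      le_trans (by gcongr; exact enorm_integral_le_lintegral_enorm _) hcs
    have h2 : ‖(b - a)⁻¹‖ₑ = (ENNReal.ofReal (b - a))⁻¹ := by
      rw [Real.enorm_eq_ofReal (by positivity), ENNReal.ofReal_inv_of_pos hba]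
    have h3 : ENNReal.ofReal (b - a) ≠ 0 := by simpa using hab
    have h4 : ENNReal.ofReal (b - a) ≠ ∞ := ENNReal.ofReal_ne_top
    rw [h2]
    calc _ ≤ ENNReal.ofReal (b - a) * ((ENNReal.ofReal (b - a))⁻¹ ^ 2 *
          (ENNReal.ofReal (b - a) * Q)) := by gcongr
      _ = (ENNReal.ofReal (b - a) * (ENNReal.ofReal (b - a))⁻¹) ^ 2 * Q := by ring
      _ = Q := by rw [ENNReal.mul_inv_cancel h3 h4]; simp
  calc ∫⁻ θ, ‖g θ - (b - a)⁻¹ • ∫ φ, g φ ∂μ‖ₑ ^ 2 ∂μ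
      ≤ ∫⁻ θ, 2 * (‖g θ - c‖ₑ ^ 2 + ‖c - (b - a)⁻¹ • ∫ φ, g φ ∂μ‖ₑ ^ 2) ∂μ :=
        lintegral_mono fun θ => enorm_sub_sq_le _ _ _
    _ = 2 * (Q + ENNReal.ofReal (b - a) * ‖c - (b - a)⁻¹ • ∫ φ, g φ ∂μ‖ₑ ^ 2) := by
        rw [lintegral_const_mul' _ _ (by simp), lintegral_add_right _ measurable_const,
          lintegral_const, hμu, mul_comm (_ ^ 2)]
    _ ≤ 2 * (Q + Q) := by gcongr
    _ = 4 * Q := by ring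

/-! ### Finite radial energy on the disc: radial limits, oscillation and quadratic means. -/

/-- A function `u` on the unit disc in polar coordinates, with radial derivative `v` and angular
derivative `w`, such that `w` is dominated by `v`. -/
structure IsPolarDisc (u v w : ℝ → ℝ → E) : Prop where
  hasDerivAt_radial : ∀ r ∈ Ioo (0 : ℝ) 1, ∀ θ, HasDerivAt (fun ρ => u ρ θ) (v r θ) r
  hasDerivAt_angular : ∀ r ∈ Ioo (0 : ℝ) 1, ∀ θ, HasDerivAt (u r) (w r θ) θ
  continuousOn_radial : ContinuousOn (Function.uncurry v) (Ioo (0 : ℝ) 1 ×ˢ univ)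
  continuousOn_angular : ContinuousOn (Function.uncurry w) (Ioo (0 : ℝ) 1 ×ˢ univ)
  enorm_angular_le : ∀ r ∈ Ioo (0 : ℝ) 1, ∀ θ, ‖w r θ‖ₑ ≤ ‖v r θ‖ₑ
  periodic : ∀ r, Function.Periodic (v r) (2 * Real.pi)

/-- The energy of the radial derivative on the annulus `1 - δ < r < 1`. -/
noncomputable def annulusEnergy (v : ℝ → ℝ → E) (δ : ℝ) : ℝ≥0∞ :=
  ∫⁻ θ in Ioc 0 (2 * Real.pi), ∫⁻ r in Ioo (1 - δ) 1, ‖v r θ‖ₑ ^ 2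

/-- The radial limit of a function in polar coordinates. -/
noncomputable def radialLimit (u : ℝ → ℝ → E) (θ : ℝ) : E :=
  limUnder (𝓝[<] (1 : ℝ)) (fun r => u r θ)

namespace IsPolarDisc

variable {u v w : ℝ → ℝ → E}

/-- Both half-open intervals are fundamental domains for translation by `2π`, under which the
integrand is invariant. -/
theorem lintegral_period (hu : IsPolarDisc u v w) (δ a : ℝ) :
    ∫⁻ θ in Ioc a (a + 2 * Real.pi), ∫⁻ r in Ioo (1 - δ) 1, ‖v r θ‖ₑ ^ 2 = annulusEnergy v δ := by
  have h0 := isAddFundamentalDomain_Ioc Real.two_pi_pos 0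
  rw [zero_add] at h0
  refine (isAddFundamentalDomain_Ioc Real.two_pi_pos a).setLIntegral_eq h0 _ fun g x => ?_
  obtain ⟨n, hn⟩ := g.2
  have hg : g +ᵥ x = x + n • (2 * Real.pi) := by
    rw [AddSubgroup.vadd_def, vadd_eq_add, ← hn, add_comm]
  rw [hg]
  refine lintegral_congr fun r => ?_
  rw [(hu.periodic r).zsmul n x]

theorem lintegral_le_annulusEnergy (hu : IsPolarDisc u v w) (δ : ℝ) {a b : ℝ}
    (hab : b - a ≤ 2 * Real.pi) :
    ∫⁻ θ in Ioo a b, ∫⁻ r in Ioo (1 - δ) 1, ‖v r θ‖ₑ ^ 2 ≤ annulusEnergy v δ := by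
  rw [← hu.lintegral_period δ a]
  exact lintegral_mono_set fun x hx => ⟨hx.1, hx.2.le.trans (by linarith)⟩

theorem aemeasurable_prod (hu : IsPolarDisc u v w) {δ : ℝ} (hδ : δ ≤ 1) {s : Set ℝ}
    (hs : MeasurableSet s) :
    AEMeasurable (Function.uncurry fun θ r => ‖v r θ‖ₑ ^ 2)
      ((volume.restrict s).prod (volume.restrict (Ioo (1 - δ) 1))) := by
  rw [Measure.prod_restrict]
  have hc : ContinuousOn (fun p : ℝ × ℝ => v p.2 p.1) (s ×ˢ Ioo (1 - δ) 1) :=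
    hu.continuousOn_radial.comp (f := Prod.swap) continuous_swap.continuousOn
      fun p hp => ⟨⟨(sub_nonneg.2 hδ).trans_lt hp.2.1, hp.2.2⟩, mem_univ _⟩
  exact ((hc.aestronglyMeasurable (hs.prod measurableSet_Ioo)).enorm.pow_const 2)

theorem continuousOn_radial_left (hu : IsPolarDisc u v w) (θ : ℝ) :
    ContinuousOn (fun r => v r θ) (Ioo 0 1) :=
  hu.continuousOn_radial.comp (f := fun r => (r, θ)) (by fun_prop) fun r hr => ⟨hr, mem_univ _⟩

theorem continuous_angular_right (hu : IsPolarDisc u v w) {r : ℝ} (hr : r ∈ Ioo (0 : ℝ) 1) :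
    Continuous (w r) := by
  rw [← continuousOn_univ]
  exact hu.continuousOn_angular.comp (f := fun θ => (r, θ)) (by fun_prop)
    fun θ _ => ⟨hr, mem_univ _⟩

theorem continuous_right (hu : IsPolarDisc u v w) {r : ℝ} (hr : r ∈ Ioo (0 : ℝ) 1) :
    Continuous (u r) :=
  continuous_iff_continuousAt.2 fun θ => (hu.hasDerivAt_angular r hr θ).continuousAt

/-- The energy in thin annuli tends to zero. -/
theorem tendsto_annulusEnergy (hu : IsPolarDisc u v w) (hfin : annulusEnergy v (1 / 2) ≠ ∞) :
    Tendsto (annulusEnergy v) (𝓝[>] 0) (𝓝 0) := by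
  -- Tonelli makes the energy the integral of one fixed function of `r`, of finite integral on
  -- `(1/2, 1)`, over shrinking intervals; absolute continuity then applies.
  have hswap : ∀ δ ≤ (1 / 2 : ℝ), annulusEnergy v δ =
      ∫⁻ r in Ioo (1 - δ) 1, ∫⁻ θ in Ioc 0 (2 * Real.pi), ‖v r θ‖ₑ ^ 2 := fun δ hδ =>
    lintegral_lintegral_swap (hu.aemeasurable_prod (δ := δ) (by linarith) measurableSet_Ioc)
  have hfin' : ∫⁻ r, (∫⁻ θ in Ioc 0 (2 * Real.pi), ‖v r θ‖ₑ ^ 2)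
      ∂(volume.restrict (Ioo (1 - 1 / 2 : ℝ) 1)) ≠ ∞ := by
    rwa [← hswap _ le_rfl]
  have hlim : Tendsto ((volume.restrict (Ioo (1 - 1 / 2 : ℝ) 1)) ∘ fun δ : ℝ => Ioo (1 - δ) 1)
      (𝓝[>] 0) (𝓝 0) := by
    have h0 : Tendsto (fun δ : ℝ => ENNReal.ofReal δ) (𝓝[>] 0) (𝓝 0) := by
      have := (ENNReal.continuous_ofReal.tendsto 0).mono_left (nhdsWithin_le_nhds (s := Ioi 0))
      simpa using this
    refine tendsto_of_tendsto_of_tendsto_of_le_of_le tendsto_const_nhds h0 (fun _ => zero_le) ?_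
    intro δ
    refine (Measure.restrict_apply_le _ _).trans (le_of_eq ?_)
    rw [Real.volume_Ioo]; congr 1; ring
  refine (tendsto_setLIntegral_zero hfin' hlim).congr' ?_
  filter_upwards [Ioo_mem_nhdsGT (show (0 : ℝ) < 1 / 2 by norm_num)] with δ hδ
  rw [hswap δ hδ.2.le, Measure.restrict_restrict measurableSet_Ioo,
    inter_eq_left.2 (Ioo_subset_Ioo_left (by linarith [hδ.2]))]

variable [CompleteSpace E]

/-- Finite energy implies the existence of almost all radial limits, with a rate. -/
theorem ae_tendsto_radialLimit (hu : IsPolarDisc u v w) (hfin : annulusEnergy v (1 / 2) ≠ ∞) :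
    ∀ᵐ θ : ℝ, Tendsto (fun r => u r θ) (𝓝[<] 1) (𝓝 (radialLimit u θ)) ∧
      ∀ δ ≤ (1 / 2 : ℝ), ∀ r ∈ Ioo (1 - δ) 1, ‖radialLimit u θ - u r θ‖ₑ ^ 2 ≤
        ENNReal.ofReal (1 - r) * ∫⁻ ρ in Ioo (1 - δ) 1, ‖v ρ θ‖ₑ ^ 2 := by
  have hW : ∀ᵐ θ : ℝ, ∫⁻ r in Ioo (1 - 1 / 2 : ℝ) 1, ‖v r θ‖ₑ ^ 2 < ∞ := by
    -- Each period has finite energy, and countably many periods cover the line.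
    have hn : ∀ n : ℤ, ∀ᵐ θ ∂volume.restrict
        (Ioc (0 + n • (2 * Real.pi)) (0 + (n + 1) • (2 * Real.pi))),
        ∫⁻ r in Ioo (1 - 1 / 2 : ℝ) 1, ‖v r θ‖ₑ ^ 2 < ∞ := by
      intro n
      rw [add_smul, one_smul, ← add_assoc]
      refine ae_lt_top' (hu.aemeasurable_prod (δ := 1 / 2) (by norm_num)
        measurableSet_Ioc).lintegral_prod_right' ?_
      rw [hu.lintegral_period]
      exact hfin
    rwa [← ae_restrict_iUnion_iff, iUnion_Ioc_add_zsmul Real.two_pi_pos,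
      Measure.restrict_univ] at hn
  filter_upwards [hW] with θ hθ
  have hsub : Ioo (1 - 1 / 2 : ℝ) 1 ⊆ Ioo 0 1 := Ioo_subset_Ioo_left (by norm_num)
  obtain ⟨l, hl, hlr⟩ := exists_tendsto_of_lintegral_deriv_sq (h := fun r => u r θ)
    (h' := fun r => v r θ) (s := 1 - 1 / 2) (by norm_num)
    (fun r hr => hu.hasDerivAt_radial r (hsub hr) θ)
    ((hu.continuousOn_radial_left θ).mono hsub) hθ.ne
  have hlim : radialLimit u θ = l := hl.limUnder_eq
  rw [hlim]
  refine ⟨hl, fun δ hδ r hr => ?_⟩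
  refine (hlr r ⟨lt_of_le_of_lt (by linarith) hr.1, hr.2⟩).trans ?_
  gcongr
  exact hr.1.le

/-- Along a sequence of radii, the limit is an almost everywhere limit of continuous functions. -/
theorem aestronglyMeasurable_radialLimit (hu : IsPolarDisc u v w)
    (hfin : annulusEnergy v (1 / 2) ≠ ∞) : AEStronglyMeasurable (radialLimit u) volume := by
  obtain ⟨x, -, hx, hlim⟩ := exists_seq_strictMono_tendsto' (zero_lt_one (α := ℝ))
  refine aestronglyMeasurable_of_tendsto_ae atTop (f := fun n => u (x n))
    (fun n => (hu.continuous_right (hx n)).aestronglyMeasurable) ?_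
  filter_upwards [hu.ae_tendsto_radialLimit hfin] with θ hθ
  exact hθ.1.comp (tendsto_nhdsWithin_iff.2 ⟨hlim, Eventually.of_forall fun n => (hx n).2⟩)

/-- The mean oscillation of the radial limit over an interval is controlled by the energy in the
annulus whose width is comparable to the length of the interval. -/
theorem meanOsc_radialLimit_le (hu : IsPolarDisc u v w) (hfin : annulusEnergy v (1 / 2) ≠ ∞)
    {a b : ℝ} (hab : a < b) (hba : b - a ≤ 2 * Real.pi) :
    (ENNReal.ofReal (b - a))⁻¹ * ∫⁻ θ in Ioo a b,
        ‖radialLimit u θ - (b - a)⁻¹ • ∫ φ in Ioo a b, radialLimit u φ‖ₑ ^ 2 ≤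
      8 * (1 + ENNReal.ofReal (4 * Real.pi)) * annulusEnergy v (min (b - a) (1 / 2)) := by
  set δ := min (b - a) (1 / 2) with hδdef
  set e := annulusEnergy v δ with he
  have hpos : 0 < b - a := sub_pos.2 hab
  have hδ : 0 < δ := lt_min hpos (by norm_num)
  have hδ2 : δ ≤ 1 / 2 := min_le_right _ _
  have hδh : δ ≤ b - a := min_le_left _ _
  -- The constant `4π` comes from the capped case `δ = 1/2`, where `b - a ≤ 2π = 4π δ`.
  have hhδ : b - a ≤ 4 * Real.pi * δ := by
    rcases min_choice (b - a) (1 / 2) with h | h <;> rw [hδdef, h]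
    · nlinarith [Real.pi_gt_three]
    · linarith
  have hsub : Ioo (1 - δ) 1 ⊆ Ioo (0 : ℝ) 1 := Ioo_subset_Ioo_left (by linarith)
  have hmeas := hu.aemeasurable_prod (δ := δ) (by linarith) (measurableSet_Ioo (a := a) (b := b))
  -- Some circle carries at most the average over `(1 - δ, 1)` of the energy above `I`.
  obtain ⟨r, hr, hrle⟩ : ∃ r ∈ Ioo (1 - δ) 1,
      ENNReal.ofReal δ * ∫⁻ θ in Ioo a b, ‖v r θ‖ₑ ^ 2 ≤ e := by
    have hvol : volume (Ioo (1 - δ) 1) = ENNReal.ofReal δ := by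
      rw [Real.volume_Ioo]; congr 1; ring
    have hδ0 : ENNReal.ofReal δ ≠ 0 := by simpa using hδ
    obtain ⟨r, hr, hle⟩ := exists_le_setLAverage (μ := volume) (s := Ioo (1 - δ) 1)
      (f := fun r => ∫⁻ θ in Ioo a b, ‖v r θ‖ₑ ^ 2) (by rwa [hvol])
      (by rw [hvol]; exact ENNReal.ofReal_ne_top) hmeas.lintegral_prod_left'
    refine ⟨r, hr, ?_⟩
    rw [setLAverage_eq, hvol, ENNReal.le_div_iff_mul_le (Or.inl hδ0)
      (Or.inl ENNReal.ofReal_ne_top), mul_comm] at hle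
    refine hle.trans ?_
    rw [← lintegral_lintegral_swap hmeas]
    exact hu.lintegral_le_annulusEnergy δ hba
  set Z := ∫⁻ θ in Ioo a b, ‖v r θ‖ₑ ^ 2 with hZ
  have hang : ∀ θ ∈ Ioo a b, ‖u r θ - u r a‖ₑ ^ 2 ≤ ENNReal.ofReal (b - a) * Z := by
    intro θ hθ
    refine (enorm_sub_sq_le_lintegral_deriv hθ.1.le
      (fun x _ => hu.hasDerivAt_angular r (hsub hr) x)
      (hu.continuous_angular_right (hsub hr)).continuousOn).trans ?_
    have h1 : Ioc a θ ⊆ Ioo a b := fun x hx => ⟨hx.1, hx.2.trans_lt hθ.2⟩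
    refine mul_le_mul' (ENNReal.ofReal_le_ofReal (by linarith [hθ.2]))
      ((lintegral_mono_set h1).trans (lintegral_mono fun x => ?_))
    exact pow_le_pow_left' (hu.enorm_angular_le r (hsub hr) x) 2
  -- The competing constant is `u r a`; the path runs from the boundary down the radius to `r`, then
  -- along the arc to `a`.
  have hconst : ∫⁻ θ in Ioo a b, ‖radialLimit u θ - u r a‖ₑ ^ 2 ≤
      ENNReal.ofReal (b - a) * (2 * (1 + ENNReal.ofReal (4 * Real.pi)) * e) := by
    calc ∫⁻ θ in Ioo a b, ‖radialLimit u θ - u r a‖ₑ ^ 2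
        ≤ ∫⁻ θ in Ioo a b, 2 * (ENNReal.ofReal δ * (∫⁻ ρ in Ioo (1 - δ) 1, ‖v ρ θ‖ₑ ^ 2) +
            ENNReal.ofReal (b - a) * Z) := by
          refine lintegral_mono_ae ?_
          filter_upwards [ae_restrict_of_ae (hu.ae_tendsto_radialLimit hfin),
            ae_restrict_mem measurableSet_Ioo] with θ hθ hθI
          refine (enorm_sub_sq_le _ (u r θ) _).trans ?_
          have h1 := hθ.2 δ hδ2 r hr
          have h2 := hang θ hθI
          have h3 : ENNReal.ofReal (1 - r) ≤ ENNReal.ofReal δ :=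
            ENNReal.ofReal_le_ofReal (by linarith [hr.1])
          gcongr
          exact h1.trans (by gcongr)
      _ = 2 * (ENNReal.ofReal δ * (∫⁻ θ in Ioo a b, ∫⁻ ρ in Ioo (1 - δ) 1, ‖v ρ θ‖ₑ ^ 2) +
            ENNReal.ofReal (b - a) * (ENNReal.ofReal (b - a) * Z)) := by
          rw [lintegral_const_mul' _ _ (by simp), lintegral_add_right _ measurable_const,
            lintegral_const_mul' _ _ ENNReal.ofReal_ne_top, lintegral_const,
            Measure.restrict_apply_univ, Real.volume_Ioo, mul_comm _ (ENNReal.ofReal (b - a))]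
      _ ≤ 2 * (ENNReal.ofReal (b - a) * e +
            ENNReal.ofReal (b - a) * (ENNReal.ofReal (4 * Real.pi) * e)) := by
          have h1 : ENNReal.ofReal (b - a) * Z ≤ ENNReal.ofReal (4 * Real.pi) * e :=
            calc ENNReal.ofReal (b - a) * Z ≤ ENNReal.ofReal (4 * Real.pi * δ) * Z := by gcongr
              _ = ENNReal.ofReal (4 * Real.pi) * (ENNReal.ofReal δ * Z) := by
                rw [ENNReal.ofReal_mul (by positivity), mul_assoc]
              _ ≤ _ := by gcongr
          have h2 := hu.lintegral_le_annulusEnergy δ hba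
          gcongr
      _ = _ := by ring
  have h0 : ENNReal.ofReal (b - a) ≠ 0 := by simpa using hab
  calc _ ≤ (ENNReal.ofReal (b - a))⁻¹ *
        (4 * (ENNReal.ofReal (b - a) * (2 * (1 + ENNReal.ofReal (4 * Real.pi)) * e))) := by
        gcongr
        exact (lintegral_sub_average_sq_le hab
          (hu.aestronglyMeasurable_radialLimit hfin).restrict (u r a)).trans (by gcongr)
    _ = ((ENNReal.ofReal (b - a))⁻¹ * ENNReal.ofReal (b - a)) *
        (8 * (1 + ENNReal.ofReal (4 * Real.pi)) * e) := by ring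
    _ = _ := by rw [ENNReal.inv_mul_cancel h0 ENNReal.ofReal_ne_top, one_mul]

/-- The distance of the radial limit to a dilation in the quadratic mean. -/
theorem lintegral_radialLimit_sub_sq_le (hu : IsPolarDisc u v w)
    (hfin : annulusEnergy v (1 / 2) ≠ ∞) {r : ℝ} (hr : r ∈ Ioo (1 / 2 : ℝ) 1) :
    ∫⁻ θ in Ioc 0 (2 * Real.pi), ‖radialLimit u θ - u r θ‖ₑ ^ 2 ≤
      ENNReal.ofReal (1 - r) * annulusEnergy v (1 / 2) := by
  rw [annulusEnergy, ← lintegral_const_mul' _ _ ENNReal.ofReal_ne_top]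
  refine lintegral_mono_ae ?_
  filter_upwards [ae_restrict_of_ae (hu.ae_tendsto_radialLimit hfin)] with θ hθ
  exact hθ.2 (1 / 2) le_rfl r ⟨by linarith [hr.1], hr.2⟩

/-- The radius `3/4` is an arbitrary choice in `(1/2, 1)`: the circle lies in the annulus of finite
energy and in a compact part of the disc, where `u` is bounded. -/
theorem lintegral_radialLimit_sq_le (hu : IsPolarDisc u v w)
    (hfin : annulusEnergy v (1 / 2) ≠ ∞) {M : ℝ≥0∞} (hM : ∀ θ, ‖u (3 / 4) θ‖ₑ ≤ M) :
    ∫⁻ θ in Ioc 0 (2 * Real.pi), ‖radialLimit u θ‖ₑ ^ 2 ≤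
      2 * (annulusEnergy v (1 / 2) + M ^ 2 * ENNReal.ofReal (2 * Real.pi)) := by
  calc ∫⁻ θ in Ioc 0 (2 * Real.pi), ‖radialLimit u θ‖ₑ ^ 2
      ≤ ∫⁻ θ in Ioc 0 (2 * Real.pi), 2 * (‖radialLimit u θ - u (3 / 4) θ‖ₑ ^ 2 + M ^ 2) := by
        refine lintegral_mono fun θ => ?_
        have h := enorm_sub_sq_le (radialLimit u θ) (u (3 / 4) θ) 0
        rw [sub_zero, sub_zero] at h
        refine h.trans ?_
        gcongr
        exact hM θ
    _ = 2 * ((∫⁻ θ in Ioc 0 (2 * Real.pi), ‖radialLimit u θ - u (3 / 4) θ‖ₑ ^ 2) +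
          M ^ 2 * ENNReal.ofReal (2 * Real.pi)) := by
        rw [lintegral_const_mul' _ _ (by simp), lintegral_add_right _ measurable_const,
          lintegral_const, Measure.restrict_apply_univ, Real.volume_Ioc, sub_zero]
    _ ≤ _ := by
        gcongr
        refine (hu.lintegral_radialLimit_sub_sq_le hfin (r := 3 / 4)
          ⟨by norm_num, by norm_num⟩).trans ?_
        refine mul_le_of_le_one_left zero_le ?_
        rw [ENNReal.ofReal_le_one]
        norm_num

/-- The quadratic means over circles converge to that of the radial limit. -/
theorem tendsto_lintegral_sq (hu : IsPolarDisc u v w) (hfin : annulusEnergy v (1 / 2) ≠ ∞)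
    (hg : ∫⁻ θ in Ioc 0 (2 * Real.pi), ‖radialLimit u θ‖ₑ ^ 2 ≠ ∞) :
    Tendsto (fun r => ∫⁻ θ in Ioc 0 (2 * Real.pi), ‖u r θ‖ₑ ^ 2) (𝓝[<] 1)
      (𝓝 (∫⁻ θ in Ioc 0 (2 * Real.pi), ‖radialLimit u θ‖ₑ ^ 2)) := by
  set μ := volume.restrict (Ioc 0 (2 * Real.pi)) with hμ
  have hN : ∀ k : ℝ → E, eLpNorm k 2 μ = (∫⁻ θ, ‖k θ‖ₑ ^ 2 ∂μ) ^ (1 / 2 : ℝ) := fun k => by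
    rw [eLpNorm_eq_lintegral_rpow_enorm_toReal two_ne_zero ENNReal.ofNat_ne_top]
    simp
  have hsq : ∀ k : ℝ → E, ∫⁻ θ, ‖k θ‖ₑ ^ 2 ∂μ = eLpNorm k 2 μ ^ 2 := fun k => by
    rw [hN, ← ENNReal.rpow_two, ← ENNReal.rpow_mul]
    norm_num
  have hgm : AEStronglyMeasurable (radialLimit u) μ :=
    (hu.aestronglyMeasurable_radialLimit hfin).restrict
  have hgN : eLpNorm (radialLimit u) 2 μ ≠ ∞ := by
    rw [hN]
    exact ENNReal.rpow_ne_top_of_nonneg (by norm_num) hg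
  have hd : Tendsto (fun r => eLpNorm (radialLimit u - u r) 2 μ) (𝓝[<] 1) (𝓝 0) := by
    have h0 : Tendsto (fun r : ℝ => ENNReal.ofReal (1 - r) * annulusEnergy v (1 / 2))
        (𝓝[<] 1) (𝓝 0) := by
      have h1 : Tendsto (fun r : ℝ => ENNReal.ofReal (1 - r)) (𝓝 1)
          (𝓝 (ENNReal.ofReal (1 - 1))) :=
        (ENNReal.continuous_ofReal.comp (continuous_const.sub continuous_id)).tendsto 1
      rw [sub_self, ENNReal.ofReal_zero] at h1
      have h2 := ENNReal.Tendsto.mul_const (h1.mono_left (nhdsWithin_le_nhds (s := Iio 1)))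
        (Or.inr hfin)
      rwa [zero_mul] at h2
    have h3 := (ENNReal.continuous_rpow_const (y := 1 / 2)).tendsto 0 |>.comp h0
    rw [ENNReal.zero_rpow_of_pos (by norm_num)] at h3
    refine tendsto_of_tendsto_of_tendsto_of_le_of_le' tendsto_const_nhds h3
      (Eventually.of_forall fun _ => zero_le) ?_
    filter_upwards [Ioo_mem_nhdsLT (show (1 / 2 : ℝ) < 1 by norm_num)] with r hr
    rw [hN]
    exact ENNReal.rpow_le_rpow (hu.lintegral_radialLimit_sub_sq_le hfin hr) (by norm_num)
  -- The triangle inequality in `L²` traps the norm of `u r` between the limit norm minus and plus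
  -- the distance.
  have hlim : Tendsto (fun r => eLpNorm (u r) 2 μ) (𝓝[<] 1)
      (𝓝 (eLpNorm (radialLimit u) 2 μ)) := by
    have hlo := ENNReal.Tendsto.sub
      (tendsto_const_nhds (x := eLpNorm (radialLimit u) 2 μ)) hd (Or.inl hgN)
    have hhi := (tendsto_const_nhds (x := eLpNorm (radialLimit u) 2 μ)).add hd
    rw [tsub_zero] at hlo
    rw [add_zero] at hhi
    refine tendsto_of_tendsto_of_tendsto_of_le_of_le' hlo hhi ?_ ?_
    all_goals
      filter_upwards [Ioo_mem_nhdsLT (show (0 : ℝ) < 1 by norm_num)] with r hr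
      have hum : AEStronglyMeasurable (u r) μ := (hu.continuous_right hr).aestronglyMeasurable
    · rw [tsub_le_iff_right]
      have h := eLpNorm_add_le hum (hgm.sub hum) (one_le_two (α := ℝ≥0∞))
      rwa [add_sub_cancel] at h
    · have h := eLpNorm_sub_le hgm (hgm.sub hum) (one_le_two (α := ℝ≥0∞))
      rwa [sub_sub_cancel] at h
  simp only [hsq]
  exact ((ENNReal.continuous_pow 2).tendsto _).comp hlim

end IsPolarDisc

/-! ### The planes `ℂ_i` as copies of the complex numbers. -/

/-- The parametrization `slicePoint i` of `ℂ_i` as a continuous real linear map. -/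
noncomputable def sliceCLM (i : ℍ[ℝ]) : ℂ →L[ℝ] ℍ[ℝ] :=
  Complex.reCLM.smulRight 1 + Complex.imCLM.smulRight i

theorem sliceCLM_apply (i : ℍ[ℝ]) (z : ℂ) : sliceCLM i z = slicePoint i z := by
  simp [sliceCLM, slicePoint, Quaternion.mul_coe_eq_smul, ← Quaternion.coe_mul_eq_smul]

theorem slicePoint_eq (i : ℍ[ℝ]) (z : ℂ) : slicePoint i z = z.re • (1 : ℍ[ℝ]) + z.im • i :=
  (sliceCLM_apply i z).symm

theorem slicePoint_add (i : ℍ[ℝ]) (z w : ℂ) :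
    slicePoint i (z + w) = slicePoint i z + slicePoint i w := by
  simp only [← sliceCLM_apply, map_add]

theorem slicePoint_sub (i : ℍ[ℝ]) (z w : ℂ) :
    slicePoint i (z - w) = slicePoint i z - slicePoint i w := by
  simp only [← sliceCLM_apply, map_sub]

theorem slicePoint_one (i : ℍ[ℝ]) : slicePoint i 1 = 1 := by simp [slicePoint_eq]

theorem slicePoint_zero (i : ℍ[ℝ]) : slicePoint i 0 = 0 := by simp [slicePoint_eq]

theorem imagUnits_mul_self {i : ℍ[ℝ]} (hi : i ∈ imagUnits) : i * i = -1 := by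
  have h1 := Quaternion.self_mul_star i
  rw [Quaternion.normSq_eq_norm_mul_self, hi.2, Quaternion.star_eq_two_re_sub, hi.1] at h1
  simp at h1
  rw [← h1, neg_neg]

theorem slicePoint_mul {i : ℍ[ℝ]} (hi : i ∈ imagUnits) (z w : ℂ) :
    slicePoint i (z * w) = slicePoint i z * slicePoint i w := by
  simp only [slicePoint_eq, Complex.mul_re, Complex.mul_im, add_mul, mul_add, smul_mul_assoc,
    mul_smul_comm, one_mul, mul_one, imagUnits_mul_self hi]
  module

theorem norm_slicePoint {i : ℍ[ℝ]} (hi : i ∈ imagUnits) (z : ℂ) : ‖slicePoint i z‖ = ‖z‖ := by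
  have hi2 : i.imI ^ 2 + i.imJ ^ 2 + i.imK ^ 2 = 1 := by
    have h := Quaternion.normSq_eq_norm_mul_self i
    rw [hi.2, Quaternion.normSq_def', hi.1] at h
    linarith
  have h := Quaternion.normSq_eq_norm_mul_self (slicePoint i z)
  rw [slicePoint_eq, Quaternion.normSq_def'] at h
  simp [hi.1] at h
  rw [← sq_eq_sq₀ (norm_nonneg _) (norm_nonneg _), sq, slicePoint_eq, ← h, Complex.sq_norm,
    Complex.normSq_apply]
  linear_combination z.im ^ 2 * hi2

theorem enorm_slicePoint {i : ℍ[ℝ]} (hi : i ∈ imagUnits) (z : ℂ) : ‖slicePoint i z‖ₑ = ‖z‖ₑ := by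
  rw [← ofReal_norm, norm_slicePoint hi, ofReal_norm]

theorem slicePoint_mem_unitBall {i : ℍ[ℝ]} (hi : i ∈ imagUnits) {z : ℂ} :
    slicePoint i z ∈ unitBall ↔ z ∈ Metric.ball (0 : ℂ) 1 := by
  simp [unitBall, norm_slicePoint hi]

theorem quaternion_norm_eq_one (q : ℍ[ℝ])
    (hq : q.re ^ 2 + q.imI ^ 2 + q.imJ ^ 2 + q.imK ^ 2 = 1) : ‖q‖ = 1 := by
  have h := Quaternion.normSq_eq_norm_mul_self q
  rw [Quaternion.normSq_def', hq] at h
  nlinarith [norm_nonneg q]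

theorem unitOf_mem_imagUnits (s : ℍ[ℝ]) : unitOf s ∈ imagUnits := by
  by_cases h : s.im = 0
  · have hs : unitOf s = ⟨0, 1, 0, 0⟩ := if_pos h
    rw [hs]
    refine ⟨rfl, ?_⟩
    exact quaternion_norm_eq_one _ (by norm_num)
  · have hs : unitOf s = ‖s.im‖⁻¹ • s.im := if_neg h
    rw [hs]
    refine ⟨by simp, ?_⟩
    rw [norm_smul, norm_inv, norm_norm, inv_mul_cancel₀ (norm_ne_zero_iff.2 h)]

theorem exists_slicePoint_unitOf (s : ℍ[ℝ]) : ∃ z, slicePoint (unitOf s) z = s := by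
  refine ⟨⟨s.re, ‖s.im‖⟩, ?_⟩
  have hsm : ‖s.im‖ • unitOf s = s.im := by
    by_cases h : s.im = 0
    · rw [h, norm_zero, zero_smul]
    · have hs : unitOf s = ‖s.im‖⁻¹ • s.im := if_neg h
      rw [hs, smul_inv_smul₀ (norm_ne_zero_iff.2 h)]
  rw [slicePoint_eq, hsm, ← Quaternion.coe_mul_eq_smul, mul_one]
  exact Quaternion.re_add_im s

/-! ### Cauchy-Riemann equations and the slice derivative. -/

variable {f : ℍ[ℝ] → ℍ[ℝ]}

theorem SliceHyperholomorphicOn.hasFDerivAt (hf : SliceHyperholomorphicOn f unitBall) {s : ℍ[ℝ]}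
    (hs : s ∈ unitBall) : HasFDerivAt f (fderiv ℝ f s) s :=
  (hf.1.differentiableAt (Metric.isOpen_ball.mem_nhds hs)).hasFDerivAt

/-- The Cauchy-Riemann equation in the plane `ℂ_i`. -/
theorem SliceHyperholomorphicOn.fderiv_slicePoint (hf : SliceHyperholomorphicOn f unitBall)
    {i : ℍ[ℝ]} (hi : i ∈ imagUnits) {z : ℂ} (hz : z ∈ Metric.ball (0 : ℂ) 1) (w : ℂ) :
    fderiv ℝ f (slicePoint i z) (slicePoint i w) =
      slicePoint i w * fderiv ℝ f (slicePoint i z) 1 := by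
  have hs := (slicePoint_mem_unitBall hi).2 hz
  have hd := hf.hasFDerivAt hs
  obtain ⟨-, α, β, h⟩ := hf
  obtain ⟨x₀, x₁⟩ := z
  obtain ⟨-, -, -, a, b, hα0, hβ1, hβ0, hα1⟩ := h i hi x₀ x₁ hs
  have hl0 : HasDerivAt (fun t : ℝ => slicePoint i ⟨t, x₁⟩) 1 x₀ := by
    simp only [slicePoint_eq]
    simpa using ((hasDerivAt_id x₀).smul_const (1 : ℍ[ℝ])).add_const (x₁ • i)
  have hl1 : HasDerivAt (fun t : ℝ => slicePoint i ⟨x₀, t⟩) i x₁ := by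
    simp only [slicePoint_eq]
    simpa using ((hasDerivAt_id x₁).smul_const i).const_add (x₀ • (1 : ℍ[ℝ]))
  have ho : unitBall ∈ 𝓝 (slicePoint i ⟨x₀, x₁⟩) := Metric.isOpen_ball.mem_nhds hs
  -- The partial derivatives of `α + iβ` are `a + ib` and `-b + ia = i(a + ib)`, so the differential
  -- along `ℂ_i` is left multiplication.
  have h0 : fderiv ℝ f (slicePoint i ⟨x₀, x₁⟩) 1 = a + i * b := by
    refine (hd.comp_hasDerivAt x₀ hl0).unique ((hα0.add (hβ0.const_mul i)).congr_of_eventuallyEq ?_)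
    filter_upwards [hl0.continuousAt.preimage_mem_nhds ho] with t ht
    exact (h i hi t x₁ ht).1
  have h1 : fderiv ℝ f (slicePoint i ⟨x₀, x₁⟩) i = -b + i * a := by
    refine (hd.comp_hasDerivAt x₁ hl1).unique ((hα1.add (hβ1.const_mul i)).congr_of_eventuallyEq ?_)
    filter_upwards [hl1.continuousAt.preimage_mem_nhds ho] with t ht
    exact (h i hi x₀ t ht).1
  rw [slicePoint_eq i w, map_add, map_smul, map_smul, h0, h1, add_mul, smul_mul_assoc,
    smul_mul_assoc, one_mul, mul_add i, ← mul_assoc, imagUnits_mul_self hi, neg_one_mul,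
    add_comm (-b)]

/-- Along `ℂ_{i_s}` the real differential is left multiplication by `p - s`, so dividing on the left
leaves its value at `1`. -/
theorem sliceDeriv_eq_fderiv (hf : SliceHyperholomorphicOn f unitBall) {s : ℍ[ℝ]}
    (hs : s ∈ unitBall) : sliceDeriv f s = fderiv ℝ f s 1 := by
  have hi := unitOf_mem_imagUnits s
  obtain ⟨z, hz⟩ := exists_slicePoint_unitOf s
  have hzb : z ∈ Metric.ball (0 : ℂ) 1 := by rwa [← slicePoint_mem_unitBall hi, hz]
  -- Identifying the value of `limUnder` needs a nontrivial filter.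
  have hne : (𝓝[slicePlane (unitOf s) \ {s}] s).NeBot := by
    rw [← mem_closure_iff_nhdsWithin_neBot, Metric.mem_closure_iff]
    intro ε hε
    refine ⟨s + slicePoint (unitOf s) (ε / 2 : ℝ), ⟨⟨z + (ε / 2 : ℝ), ?_⟩, ?_⟩, ?_⟩
    · rw [slicePoint_add, hz]
    · rw [mem_singleton_iff, add_eq_left, ← norm_eq_zero, norm_slicePoint hi]
      simp [hε.ne']
    · rw [dist_self_add_right, norm_slicePoint hi, Complex.norm_real, Real.norm_eq_abs,
        abs_of_pos (by positivity)]
      linarith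
  refine Tendsto.limUnder_eq ?_
  rw [tendsto_iff_norm_sub_tendsto_zero]
  refine ((hasFDerivAt_iff_tendsto.1 (hf.hasFDerivAt hs)).mono_left nhdsWithin_le_nhds).congr' ?_
  filter_upwards [self_mem_nhdsWithin] with p hp
  obtain ⟨⟨y, rfl⟩, hps⟩ := hp
  have hne0 : slicePoint (unitOf s) y - s ≠ 0 := sub_ne_zero.2 hps
  have hcr : fderiv ℝ f s (slicePoint (unitOf s) y - s) =
      (slicePoint (unitOf s) y - s) * fderiv ℝ f s 1 := by
    have h := hf.fderiv_slicePoint hi hzb (y - z)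
    rwa [slicePoint_sub, hz] at h
  rw [hcr, ← norm_inv, ← norm_mul, mul_sub, inv_mul_cancel_left₀ hne0]

/-- The complex structure on the quaternions given by multiplication with elements of `ℂ_i`
from the left. -/
@[reducible]
noncomputable def sliceNormedSpace {i : ℍ[ℝ]} (hi : i ∈ imagUnits) : NormedSpace ℂ ℍ[ℝ] where
  smul z x := slicePoint i z * x
  one_smul x := show slicePoint i 1 * x = x by rw [slicePoint_one, one_mul]
  mul_smul z w x := show slicePoint i (z * w) * x = slicePoint i z * (slicePoint i w * x) by
    rw [slicePoint_mul hi, mul_assoc]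
  smul_zero z := mul_zero (slicePoint i z)
  zero_smul x := show slicePoint i 0 * x = 0 by rw [slicePoint_zero, zero_mul]
  smul_add z := mul_add (slicePoint i z)
  add_smul z w x := show slicePoint i (z + w) * x = slicePoint i z * x + slicePoint i w * x by
    rw [slicePoint_add, add_mul]
  norm_smul_le z x := show ‖slicePoint i z * x‖ ≤ ‖z‖ * ‖x‖ by
    rw [norm_mul, norm_slicePoint hi]

/-- The slice derivative is continuous in each plane `ℂ_i`, since the restriction of a slice
hyperholomorphic function to `ℂ_i` is holomorphic for the complex structure given by `i`. -/
theorem SliceHyperholomorphicOn.continuousOn_fderiv (hf : SliceHyperholomorphicOn f unitBall)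
    {i : ℍ[ℝ]} (hi : i ∈ imagUnits) :
    ContinuousOn (fun z => fderiv ℝ f (slicePoint i z) 1) (Metric.ball (0 : ℂ) 1) := by
  let _ := sliceNormedSpace hi
  have hd : ∀ z ∈ Metric.ball (0 : ℂ) 1,
      HasDerivAt (fun z => f (slicePoint i z)) (fderiv ℝ f (slicePoint i z) 1) z := by
    intro z hz
    rw [hasDerivAt_iff_hasFDerivAt, hasFDerivAt_iff_tendsto]
    have hr : HasFDerivAt (fun z => f (slicePoint i z))
        ((fderiv ℝ f (slicePoint i z)).comp (sliceCLM i)) z := by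
      have h1 : HasFDerivAt (slicePoint i) (sliceCLM i) z := by
        simpa only [funext (sliceCLM_apply i)] using (sliceCLM i).hasFDerivAt (x := z)
      exact (hf.hasFDerivAt ((slicePoint_mem_unitBall hi).2 hz)).comp z h1
    -- Real and complex error quotients coincide, because the real differential is already complex
    -- linear.
    refine (hasFDerivAt_iff_tendsto.1 hr).congr fun y => ?_
    rw [ContinuousLinearMap.comp_apply, sliceCLM_apply, hf.fderiv_slicePoint hi hz]
    rfl
  have hdo : DifferentiableOn ℂ (fun z => f (slicePoint i z)) (Metric.ball (0 : ℂ) 1) :=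
    fun z hz => (hd z hz).differentiableAt.differentiableWithinAt
  exact (hdo.deriv Metric.isOpen_ball).continuousOn.congr fun z hz => (hd z hz).deriv.symm

theorem circleMap_zero_mem_ball {r : ℝ} (hr : r ∈ Ioo (0 : ℝ) 1) (θ : ℝ) :
    circleMap 0 r θ ∈ Metric.ball (0 : ℂ) 1 := by
  rw [mem_ball_zero_iff, norm_circleMap_zero, abs_of_pos hr.1]
  exact hr.2

/-! ### Slice hyperholomorphic functions in polar coordinates. -/

/-- The radial derivative of a slice hyperholomorphic function in the plane `ℂ_i`. -/
noncomputable def radialDeriv (f : ℍ[ℝ] → ℍ[ℝ]) (i : ℍ[ℝ]) (r θ : ℝ) : ℍ[ℝ] :=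
  slicePoint i (circleMap 0 1 θ) * fderiv ℝ f (polarPoint i r θ) 1

/-- The angular derivative of a slice hyperholomorphic function in the plane `ℂ_i`. -/
noncomputable def angularDeriv (f : ℍ[ℝ] → ℍ[ℝ]) (i : ℍ[ℝ]) (r θ : ℝ) : ℍ[ℝ] :=
  slicePoint i (circleMap 0 r θ * Complex.I) * fderiv ℝ f (polarPoint i r θ) 1

theorem enorm_radialDeriv {i : ℍ[ℝ]} (hi : i ∈ imagUnits) (r θ : ℝ) :
    ‖radialDeriv f i r θ‖ₑ = ‖fderiv ℝ f (polarPoint i r θ) 1‖ₑ := by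
  rw [radialDeriv, enorm_mul, enorm_slicePoint hi, ← ofReal_norm (circleMap 0 1 θ),
    norm_circleMap_zero]
  simp

theorem SliceHyperholomorphicOn.isPolarDisc (hf : SliceHyperholomorphicOn f unitBall)
    {i : ℍ[ℝ]} (hi : i ∈ imagUnits) :
    IsPolarDisc (fun r θ => f (polarPoint i r θ)) (radialDeriv f i) (angularDeriv f i) := by
  have hcm : Continuous fun p : ℝ × ℝ => circleMap 0 p.1 p.2 := by
    unfold circleMap
    fun_prop
  have hsl : Continuous (slicePoint i) := by
    simpa only [funext (sliceCLM_apply i)] using (sliceCLM i).continuous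
  have hD : ContinuousOn (fun p : ℝ × ℝ => fderiv ℝ f (polarPoint i p.1 p.2) 1)
      (Ioo (0 : ℝ) 1 ×ˢ univ) :=
    (hf.continuousOn_fderiv hi).comp (f := fun p : ℝ × ℝ => circleMap 0 p.1 p.2)
      hcm.continuousOn fun p hp => circleMap_zero_mem_ball hp.1 _
  have hchain : ∀ r ∈ Ioo (0 : ℝ) 1, ∀ θ : ℝ, ∀ c : ℝ → ℂ, ∀ c' : ℂ, ∀ t : ℝ,
      c t = circleMap 0 r θ → HasDerivAt c c' t →
      HasDerivAt (fun t => f (slicePoint i (c t)))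
        (slicePoint i c' * fderiv ℝ f (polarPoint i r θ) 1) t := by
    intro r hr θ c c' t hct hc
    have hz := circleMap_zero_mem_ball hr θ
    have h1 := (sliceCLM i).hasFDerivAt.comp_hasDerivAt t hc
    simp only [sliceCLM_apply, Function.comp_def] at h1
    have h2 := hf.hasFDerivAt ((slicePoint_mem_unitBall hi).2 hz)
    rw [polarPoint, ← hf.fderiv_slicePoint hi hz]
    rw [← hct] at h2 ⊢
    exact h2.comp_hasDerivAt t h1
  refine ⟨fun r hr θ => ?_, fun r hr θ => ?_, ?_, ?_, fun r hr θ => ?_, fun r θ => ?_⟩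
  · refine hchain r hr θ (fun ρ => circleMap 0 ρ θ) _ r rfl ?_
    simp only [circleMap, zero_add, Complex.ofReal_one, one_mul]
    simpa using (hasDerivAt_id r).ofReal_comp.mul_const (Complex.exp (θ * Complex.I))
  · exact hchain r hr θ (circleMap 0 r) _ θ rfl (hasDerivAt_circleMap 0 r θ)
  · exact ContinuousOn.mul (hsl.comp (hcm.comp (by fun_prop :
      Continuous fun p : ℝ × ℝ => ((1 : ℝ), p.2)))).continuousOn hD
  · exact ContinuousOn.mul (hsl.comp (hcm.mul continuous_const)).continuousOn hD
  · rw [enorm_radialDeriv hi, angularDeriv, enorm_mul, enorm_slicePoint hi]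
    refine mul_le_of_le_one_left zero_le ?_
    rw [← ofReal_norm, norm_mul, norm_circleMap_zero, Complex.norm_I, mul_one, abs_of_pos hr.1,
      ENNReal.ofReal_le_one]
    exact hr.2.le
  · simp only [radialDeriv, polarPoint, periodic_circleMap _ _ θ]

/-- The energy lacks the polar Jacobian `r`, but `r > 1/2` on the annulus, so a factor `2`
compensates. -/
theorem annulusEnergy_radialDeriv_le (hf : SliceHyperholomorphicOn f unitBall)
    {i : ℍ[ℝ]} (hi : i ∈ imagUnits) :
    annulusEnergy (radialDeriv f i) (1 / 2) ≤
      2 * ∫⁻ z in Metric.ball (0 : ℂ) 1, ‖sliceDeriv f (slicePoint i z)‖ₑ ^ 2 := by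
  have hu := hf.isPolarDisc hi
  have hmeas := hu.aemeasurable_prod (δ := 1 / 2) (by norm_num)
    (measurableSet_Ioo (a := -Real.pi) (b := Real.pi))
  have hE : annulusEnergy (radialDeriv f i) (1 / 2) =
      ∫⁻ p in Ioo (1 - 1 / 2 : ℝ) 1 ×ˢ Ioo (-Real.pi) Real.pi,
        ‖radialDeriv f i p.1 p.2‖ₑ ^ 2 := by
    rw [← hu.lintegral_period _ (-Real.pi), Measure.volume_eq_prod, ← Measure.prod_restrict,
      show -Real.pi + 2 * Real.pi = Real.pi by ring, ← restrict_Ioo_eq_restrict_Ioc]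
    exact (lintegral_prod_symm _ hmeas.prod_swap).symm
  rw [hE, ← lintegral_indicator measurableSet_ball, ← Complex.lintegral_comp_polarCoord_symm,
    ← lintegral_const_mul' _ _ (by simp)]
  have hsub : Ioo (1 - 1 / 2 : ℝ) 1 ×ˢ Ioo (-Real.pi) Real.pi ⊆ polarCoord.target := by
    rw [polarCoord_target]
    exact prod_mono (fun r hr => lt_trans (by norm_num) hr.1) subset_rfl
  refine le_trans ?_ (lintegral_mono_set hsub)
  refine setLIntegral_mono' (measurableSet_Ioo.prod measurableSet_Ioo) fun p hp => ?_
  have hp1 : p.1 ∈ Ioo (0 : ℝ) 1 := ⟨lt_trans (by norm_num) hp.1.1, hp.1.2⟩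
  have hz : Complex.polarCoord.symm p = circleMap 0 p.1 p.2 := by
    rw [Complex.polarCoord_symm_apply, circleMap, zero_add, Complex.exp_mul_I]
    push_cast
    rfl
  have hmem := circleMap_zero_mem_ball hp1 p.2
  rw [hz, indicator_of_mem hmem, smul_eq_mul, ← mul_assoc, enorm_radialDeriv hi,
    sliceDeriv_eq_fderiv hf ((slicePoint_mem_unitBall hi).2 hmem)]
  refine le_mul_of_one_le_left zero_le ?_
  rw [← ENNReal.ofReal_ofNat, ← ENNReal.ofReal_mul (by norm_num), ENNReal.one_le_ofReal]
  linarith [hp.1.1]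

/-- Compactness of the full quaternionic ball, rather than of a single disc, makes the bound
independent of `i`. -/
theorem exists_enorm_le_on_sphere (hf : SliceHyperholomorphicOn f unitBall) :
    ∃ M : ℝ≥0∞, M ≠ ∞ ∧ ∀ i ∈ imagUnits, ∀ θ, ‖f (polarPoint i (3 / 4) θ)‖ₑ ≤ M := by
  have hsub : Metric.closedBall (0 : ℍ[ℝ]) (3 / 4) ⊆ unitBall :=
    Metric.closedBall_subset_ball (by norm_num)
  obtain ⟨C, hC⟩ := (isCompact_closedBall (0 : ℍ[ℝ]) (3 / 4)).exists_bound_of_continuousOn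
    (hf.1.continuousOn.mono hsub)
  refine ⟨ENNReal.ofReal C, ENNReal.ofReal_ne_top, fun i hi θ => ?_⟩
  rw [← ofReal_norm]
  refine ENNReal.ofReal_le_ofReal (hC _ ?_)
  rw [mem_closedBall_zero_iff, polarPoint, norm_slicePoint hi, norm_circleMap_zero]
  norm_num [abs_of_pos]

/-! ### From the Dirichlet space to the Hardy, BMO and VMO spaces. -/

theorem annulusEnergy_le_of_mem_dirichletSpace (hf : f ∈ dirichletSpace) {i : ℍ[ℝ]}
    (hi : i ∈ imagUnits) :
    annulusEnergy (radialDeriv f i) (1 / 2) ≤ 2 * ⨆ i ∈ imagUnits,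
      ∫⁻ z in Metric.ball (0 : ℂ) 1, ‖sliceDeriv f (slicePoint i z)‖ₑ ^ 2 := by
  refine (annulusEnergy_radialDeriv_le hf.1 hi).trans ?_
  gcongr
  exact le_iSup₂ (f := fun i (_ : i ∈ imagUnits) =>
    ∫⁻ z in Metric.ball (0 : ℂ) 1, ‖sliceDeriv f (slicePoint i z)‖ₑ ^ 2) i hi

theorem annulusEnergy_ne_top (hf : f ∈ dirichletSpace) {i : ℍ[ℝ]}
    (hi : i ∈ imagUnits) :
    annulusEnergy (radialDeriv f i) (1 / 2) ≠ ∞ :=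
  ne_top_of_le_ne_top (ENNReal.mul_ne_top (by simp) hf.2.ne)
    (annulusEnergy_le_of_mem_dirichletSpace hf hi)

theorem meanOsc_le_annulusEnergy (hf : f ∈ dirichletSpace) {i : ℍ[ℝ]}
    (hi : i ∈ imagUnits) {a b : ℝ} (hab : a < b)
    (hba : b - a ≤ 2 * Real.pi) :
    meanOsc f i a b ≤ 8 * (1 + ENNReal.ofReal (4 * Real.pi)) *
      annulusEnergy (radialDeriv f i) (min (b - a) (1 / 2)) :=
  (hf.1.isPolarDisc hi).meanOsc_radialLimit_le (annulusEnergy_ne_top hf hi) hab hba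

theorem mem_hardySpace_of_mem_dirichletSpace (hf : f ∈ dirichletSpace) : f ∈ hardySpace 2 := by
  obtain ⟨M, hM, hfM⟩ := exists_enorm_le_on_sphere hf.1
  set S := ⨆ i ∈ imagUnits,
    ∫⁻ z in Metric.ball (0 : ℂ) 1, ‖sliceDeriv f (slicePoint i z)‖ₑ ^ 2 with hS
  have hSt : S ≠ ∞ := hf.2.ne
  set B : ℝ≥0∞ := 2 * (2 * S + M ^ 2 * ENNReal.ofReal (2 * Real.pi)) with hB
  have hBt : B ≠ ∞ := by
    refine ENNReal.mul_ne_top (by simp) (ENNReal.add_ne_top.2 ⟨ENNReal.mul_ne_top (by simp) hSt,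
      ENNReal.mul_ne_top (ENNReal.pow_ne_top hM) ENNReal.ofReal_ne_top⟩)
  have hc : (ENNReal.ofReal (2 * Real.pi))⁻¹ ≠ ∞ := by
    simp [Real.pi_pos]
  have hle : ∀ i ∈ imagUnits, ∫⁻ θ in Ioc 0 (2 * Real.pi), ‖boundaryValue f i θ‖ₑ ^ 2 ≤ B := by
    intro i hi
    refine ((hf.1.isPolarDisc hi).lintegral_radialLimit_sq_le (annulusEnergy_ne_top hf hi)
      (hfM i hi)).trans ?_
    rw [hB]
    gcongr
    exact annulusEnergy_le_of_mem_dirichletSpace hf hi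
  refine ⟨hf.1, fun i => ((ENNReal.ofReal (2 * Real.pi))⁻¹ *
    ∫⁻ θ in Ioc 0 (2 * Real.pi), ‖boundaryValue f i θ‖ₑ ^ 2) ^ (1 / 2 : ℝ), fun i hi => ?_, ?_⟩
  · have h := (hf.1.isPolarDisc hi).tendsto_lintegral_sq (annulusEnergy_ne_top hf hi)
      (ne_top_of_le_ne_top hBt (hle i hi))
    have h2 := (ENNReal.continuous_rpow_const (y := 1 / 2)).tendsto _ |>.comp
      (ENNReal.Tendsto.const_mul (a := (ENNReal.ofReal (2 * Real.pi))⁻¹) h (Or.inr hc))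
    refine h2.congr fun r => ?_
    simp only [Function.comp_apply, hardyMean, ENNReal.rpow_two]
  · refine lt_of_le_of_lt (iSup₂_le fun i hi =>
      ENNReal.rpow_le_rpow (mul_le_mul_right (hle i hi) _) (by norm_num)) ?_
    exact ENNReal.rpow_lt_top_of_nonneg (by norm_num) (ENNReal.mul_ne_top hc hBt)

theorem mem_BMOSH_of_mem_dirichletSpace (hf : f ∈ dirichletSpace) : f ∈ BMOSH := by
  refine ⟨mem_hardySpace_of_mem_dirichletSpace hf, fun i hi => ?_, ?_⟩
  · filter_upwards [(hf.1.isPolarDisc hi).ae_tendsto_radialLimit (annulusEnergy_ne_top hf hi)]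
      with θ hθ using ⟨_, hθ.1⟩
  · refine lt_of_le_of_lt (iSup₂_le fun i hi => ENNReal.rpow_le_rpow
      (iSup₂_le fun a b => iSup₂_le fun hab hba => ((meanOsc_le_annulusEnergy hf hi hab hba).trans
      (mul_le_mul_right (le_trans ?_ (annulusEnergy_le_of_mem_dirichletSpace hf hi)) _)))
      (by norm_num)) ?_
    -- The cap at `1/2` places every annulus inside the one controlled by the Dirichlet supremum.
    · refine lintegral_mono fun θ => lintegral_mono_set (Ioo_subset_Ioo_left ?_)
      linarith [min_le_right (b - a) (1 / 2 : ℝ)]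
    · refine ENNReal.rpow_lt_top_of_nonneg (by norm_num) (ENNReal.mul_ne_top ?_
        (ENNReal.mul_ne_top (by simp) hf.2.ne))
      exact ENNReal.mul_ne_top (by simp) (ENNReal.add_ne_top.2 ⟨by simp, ENNReal.ofReal_ne_top⟩)

theorem mem_VMOSH_of_mem_dirichletSpace (hf : f ∈ dirichletSpace) : f ∈ VMOSH := by
  refine ⟨mem_BMOSH_of_mem_dirichletSpace hf, fun i hi => ?_⟩
  have hmin : Tendsto (fun t : ℝ => min t (1 / 2)) (𝓝[>] 0) (𝓝[>] 0) := by
    refine tendsto_nhdsWithin_iff.2 ⟨?_, ?_⟩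
    · have h : Tendsto (fun t : ℝ => min t (1 / 2)) (𝓝 0) (𝓝 (min 0 (1 / 2))) :=
        (continuous_id.min continuous_const).tendsto 0
      rw [min_eq_left (by norm_num)] at h
      exact h.mono_left nhdsWithin_le_nhds
    · filter_upwards [self_mem_nhdsWithin] with t ht
      exact lt_min (mem_Ioi.1 ht) (by norm_num)
  have hE := (hf.1.isPolarDisc hi).tendsto_annulusEnergy (annulusEnergy_ne_top hf hi)
  have hlim := ENNReal.Tendsto.const_mul (a := 8 * (1 + ENNReal.ofReal (4 * Real.pi)))
    (hE.comp (hmin.comp (tendsto_comap (f := fun I : ℝ × ℝ => I.2 - I.1))))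
    (Or.inr (ENNReal.mul_ne_top (by simp) (ENNReal.add_ne_top.2 ⟨by simp, ENNReal.ofReal_ne_top⟩)))
  rw [mul_zero] at hlim
  refine tendsto_of_tendsto_of_tendsto_of_le_of_le' tendsto_const_nhds hlim
    (Eventually.of_forall fun _ => zero_le) ?_
  filter_upwards [preimage_mem_comap (Ioo_mem_nhdsGT Real.two_pi_pos)] with I hI
  exact meanOsc_le_annulusEnergy hf hi (sub_pos.1 hI.1) hI.2.le

end SliceHyper

theorem mainTheorem9 : SliceHyper.dirichletSpace ⊆ SliceHyper.VMOSH :=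
  fun _ hf => SliceHyper.mem_VMOSH_of_mem_dirichletSpace hf
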